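/- Let $\mathcal M=(S,A,P)$ be a finite Markov decision process: $S$ and $A$ are finite sets and $P\colon S\times A\times S\to[0,1]$ satisfies $\sum_{s'\in S}P(s,a,s')\in\{0,1\}$ for all $s\in S$, $a\in A$; the set $A(s)$ of enabled actions $a$, those with $\sum_{s'}P(s,a,s')=1$, is assumed non-empty for every $s\in S$. Write $\mathrm{Post}(s,a)=\{s'\in S\mid P(s,a,s')>0\}$. Let $T\subseteq S$ be a set of target states and $\mathrm{rew}\colon S\to\mathbb R_{\ge 0}$ a reward function. For an infinite path $s_0s_1\ldots\in S^\omega$, let $\mathrm{rew}^{\lozenge T}(s_0s_1\ldots)=\sum_{0\le k<n}\mathrm{rew}(s_k)$ with $n=\min\{i\mid s_i\in T\}$ if some $s_i$ lies in $T$, and $\mathrm{rew}^{\lozenge T}(s_0s_1\ldots)=\infty$ otherwise. A strategy is a map $\sigma\colon S\to A$ with $\sigma(s)\in A(s)$ for all $s$; let $\mathbb E^{\sigma}_s(\lozenge T)$ be the expected value of $\mathrm{rew}^{\lozenge T}$ with respect to the probability measure on the infinite paths of the Markov chain with initial state $s$ and transition probabilities $P(u,\sigma(u),u')$, and let $\mathbb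 E^{\max}_s(\lozenge T)=\max_\sigma\mathbb E^{\sigma}_s(\lozenge T)\in[0,\infty]$. For $r\colon S\to\mathbb N\cup\{\infty\}$ and $x\colon S\to[0,\infty]$ put $\mathcal D^{\max}(r)(s)=0$ and $\mathcal E^{\max}(x)(s)=0$ if $s\in T$, and, if $s\in S\setminus T$, $$\mathcal D^{\max}(r)(s)=1+\max_{a\in A(s)}\ \min_{s'\in\mathrm{Post}(s,a)}r(s'),\qquad \mathcal E^{\max}(x)(s)=\mathrm{rew}(s)+\max_{a\in A(s)}\ \sum_{s'\in\mathrm{Post}(s,a)}P(s,a,s')\cdot x(s').$$ Suppose that $x\colon S\to[0,\infty]$ and $r\colon S\to\mathbb N\cup\{\infty\}$ satisfy, with pointwise inequalities, 1) $\mathcal D^{\max}(r)\le r$, 2) $\mathcal E^{\max}(x)\le x$, and 3) for all $s\in S$, $x(s)<\infty$ implies $r(s)<\infty$. Then $\mathbb E^{\max}_s(\lozenge T)\le x(s)$ for all $s\in S$. -/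

import Mathlib

open MeasureTheory ProbabilityTheory
open scoped ENNReal NNReal

/-- A Markov decision process with (finite) state set `S` and (finite) action set `A`. The bound
`P s a s' ≤ 1` follows from `sum_P`. -/
structure MDP (S A : Type*) [Fintype S] where
  /-- the transition probability function -/
  P : S → A → S → ℝ≥0
  sum_P : ∀ s a, ∑ s', P s a s' = 0 ∨ ∑ s', P s a s' = 1
  exists_enabled : ∀ s, ∃ a, ∑ s', P s a s' = 1

/-- A discrete-time Markov chain: an MDP with exactly one enabled action in every state. -/
structure DTMC (S A : Type*) [Fintype S] extends MDP S A where
  unique_enabled : ∀ s, ∃! a, ∑ s', P s a s' = 1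

noncomputable section

namespace MDP

variable {S A : Type*} [Fintype S] (M : MDP S A)

/-- The set `Act(s)` of actions enabled in `s`. -/
def act (s : S) : Set A := {a | ∑ s', M.P s a s' = 1}

/-- The set `Post(s, a)` of `a`-successors of `s`. -/
def post (s : S) (a : A) : Finset S := {s' | 0 < M.P s a s'}

/-- A memoryless deterministic strategy: a choice of an enabled action in every state. -/
def Strategy : Type _ := {σ : S → A // ∀ s, σ s ∈ M.act s}

open Classical in
/-- The induced Markov chain, which retains only the actions chosen by the strategy. -/
def induced (σ : M.Strategy) : DTMC S A where
  P s a s' := if a = σ.1 s then M.P s a s' else 0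
  sum_P s a := by
    by_cases h : a = σ.1 s
    · simpa [h] using M.sum_P s (σ.1 s)
    · simp [h]
  exists_enabled s := ⟨σ.1 s, by simpa [act] using σ.2 s⟩
  unique_enabled s := by
    refine ⟨σ.1 s, by simpa [act] using σ.2 s, fun a ha => ?_⟩
    by_contra h
    simp [h] at ha

end MDP

namespace DTMC

variable {S A : Type*} [Fintype S] (D : DTMC S A)

/-- The unique enabled action in `s`. -/
def action (s : S) : A := (D.unique_enabled s).choose

/-- The distribution of the successor of `s`. -/
def step (s : S) : PMF S :=
  PMF.ofFintype (fun s' => (D.P s (D.action s) s' : ℝ≥0∞)) (by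
    rw [← ENNReal.ofNNReal_finsetSum, ENNReal.coe_eq_one]
    exact (D.unique_enabled s).choose_spec.1)

variable [MeasurableSpace S] [DiscreteMeasurableSpace S]

/-- The one-step transition kernel. -/
def stepKernel : Kernel S S := Kernel.ofFunOfCountable fun s => (D.step s).toMeasure

instance : IsMarkovKernel D.stepKernel :=
  ⟨fun s => inferInstanceAs (IsProbabilityMeasure (D.step s).toMeasure)⟩

/-- The transition from a history `s₀ … sₙ` to the next state; it depends only on `sₙ`. -/
def historyKernel (n : ℕ) : Kernel (Π _ : Finset.Iic n, S) S :=
  D.stepKernel.comap (fun h => h ⟨n, Finset.mem_Iic.2 le_rfl⟩) (measurable_pi_apply _)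

instance (n : ℕ) : IsMarkovKernel (D.historyKernel n) := by
  unfold historyKernel; infer_instance

/-- The probability measure on infinite paths of the chain started in `s`. -/
def pathMeasure (s : S) : Measure (ℕ → S) :=
  Kernel.traj (X := fun _ => S) D.historyKernel 0 (fun _ => s)

end DTMC

open Classical in
/-- The reward collected along an infinite path before it visits `T` for the first time; it is
`∞` if the path never visits `T`. -/
def rewardUntil {S : Type*} (T : Set S) (rew : S → ℝ≥0) (ω : ℕ → S) : ℝ≥0∞ :=
  if ∃ i, ω i ∈ T then ∑ k ∈ Finset.range (sInf {i | ω i ∈ T}), (rew (ω k) : ℝ≥0∞) else ∞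

/-- The expected reward collected from `s` until reaching `T` in a Markov chain. -/
def DTMC.expReward {S A : Type*} [Fintype S] [MeasurableSpace S] [DiscreteMeasurableSpace S]
    (D : DTMC S A) (T : Set S) (rew : S → ℝ≥0) (s : S) : ℝ≥0∞ :=
  ∫⁻ ω, rewardUntil T rew ω ∂(D.pathMeasure s)

namespace MDP

variable {S A : Type*} [Fintype S] (M : MDP S A) (T : Set S) (rew : S → ℝ≥0)

/-- The maximal expected reward, i.e. the maximum over all strategies. -/
def expRewardMax [MeasurableSpace S] [DiscreteMeasurableSpace S] (s : S) : ℝ≥0∞ :=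
  ⨆ σ : M.Strategy, (M.induced σ).expReward T rew s

/-- The supremum defining `expRewardMax` is a maximum. -/
theorem exists_expRewardMax_eq [Finite A] [MeasurableSpace S] [DiscreteMeasurableSpace S] (s : S) :
    ∃ σ : M.Strategy, M.expRewardMax T rew s = (M.induced σ).expReward T rew s := by
  have : Nonempty M.Strategy :=
    ⟨⟨fun s => (M.exists_enabled s).choose, fun s => (M.exists_enabled s).choose_spec⟩⟩
  have : Finite M.Strategy := inferInstanceAs (Finite {σ : S → A // ∀ s, σ s ∈ M.act s})
  obtain ⟨σ, hσ⟩ := exists_eq_ciSup_of_finite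
    (f := fun σ : M.Strategy => (M.induced σ).expReward T rew s)
  exact ⟨σ, hσ.symm⟩

open Classical in
/-- The distance operator for `max`. -/
def distMax (r : S → ℕ∞) (s : S) : ℕ∞ :=
  if s ∈ T then 0 else 1 + ⨆ a ∈ M.act s, ⨅ s' ∈ M.post s a, r s'

open Classical in
/-- The Bellman operator for maximal expected rewards. -/
def bellmanMax (x : S → ℝ≥0∞) (s : S) : ℝ≥0∞ :=
  if s ∈ T then 0
  else (rew s : ℝ≥0∞) + ⨆ a ∈ M.act s, ∑ s' ∈ M.post s a, (M.P s a s' : ℝ≥0∞) * x s'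

/-- Valid certificates `(x, r)` for upper bounds on maximal expected rewards. -/
structure IsValidUpperMax (x : S → ℝ≥0∞) (r : S → ℕ∞) : Prop where
  dist_le : M.distMax T r ≤ r
  bellman_le : M.bellmanMax T rew x ≤ x
  finite_rank : ∀ s, x s < ∞ → r s < ⊤

end MDP

end

/-! Fix a strategy. The Bellman inequality makes `x` a supersolution of the induced chain outside
`T`, and telescoping expectations (`lintegral_costBefore_le`) bounds the expected reward collected
before `T`. This is the desired quantity only if `T` is reached almost surely, since `rewardUntil`
is `∞` on the other paths.

The ranks supply that. The set `{x ≠ ∞}` is closed under transitions outside `T`; ranks are finite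
there, and every enabled action may lower the rank. As `S` is finite, this yields a function with
expected drop at least 1 outside `T` (`exists_hittingTime_bound`), and the same telescoping with
cost 1 makes the expected hitting time finite. -/

namespace DTMC

variable {S A : Type*} [Fintype S] [MeasurableSpace S] [DiscreteMeasurableSpace S] (D : DTMC S A)

/-- Given the history up to time `n`, the state at time `n + 1` is distributed as a step from the
state at time `n`. -/
theorem lintegral_pathMeasure_succ (s : S) (n : ℕ) (f : (Π _ : Finset.Iic n, S) → S → ℝ≥0∞) :
    ∫⁻ ω, f (Preorder.frestrictLe n ω) (ω (n + 1)) ∂D.pathMeasure s =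
      ∫⁻ ω, ∑ s', D.step (ω n) s' * f (Preorder.frestrictLe n ω) s' ∂D.pathMeasure s := by
  have hf : Measurable f.uncurry := measurable_of_countable _
  have hr : Measurable (Preorder.frestrictLe (π := fun _ : ℕ => S) n) := by fun_prop
  have hstep (h : Π _ : Finset.Iic n, S) : ∫⁻ s', f h s' ∂D.historyKernel n h =
      ∑ s', D.step (h ⟨n, Finset.mem_Iic.2 le_rfl⟩) s' * f h s' := by
    rw [historyKernel, Kernel.comap_apply, lintegral_fintype]
    refine Finset.sum_congr rfl fun s' _ => ?_
    rw [mul_comm]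
    congr 1
    exact PMF.toMeasure_apply_singleton _ _ (measurableSet_singleton _)
  calc ∫⁻ ω, f (Preorder.frestrictLe n ω) (ω (n + 1)) ∂D.pathMeasure s
      = ∫⁻ p, f.uncurry p ∂((D.pathMeasure s).map
          fun ω => (Preorder.frestrictLe (π := fun _ : ℕ => S) n ω, ω (n + 1))) := by
        rw [lintegral_map hf (by fun_prop)]; rfl
    _ = ∫⁻ h, ∫⁻ s', f h s' ∂D.historyKernel n h
          ∂((D.pathMeasure s).map (Preorder.frestrictLe n)) := by
        rw [pathMeasure, ← Kernel.partialTraj_compProd_eq_map_traj (Nat.zero_le n),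
          Measure.lintegral_compProd hf, Kernel.traj_map_frestrictLe_apply]
        rfl
    _ = _ := by
        simp_rw [hstep]
        rw [lintegral_map (measurable_of_countable _) hr]
        rfl

theorem lintegral_pathMeasure_zero (s : S) (y : S → ℝ≥0∞) :
    ∫⁻ ω, y (ω 0) ∂D.pathMeasure s = y s := by
  have hy : Measurable fun ω : ℕ → S => y (ω 0) :=
    (measurable_of_countable y).comp (measurable_pi_apply 0)
  have : IsProbabilityMeasure (D.pathMeasure s) := by unfold pathMeasure; infer_instance
  rw [pathMeasure, Kernel.lintegral_traj _ hy, ← pathMeasure]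
  simp [Function.updateFinset]

end DTMC

/-- The paths that avoid `T` at all times before `n`. -/
def pathsAvoiding {S : Type*} (T : Set S) (n : ℕ) : Set (ℕ → S) := {ω | ∀ j < n, ω j ∉ T}

theorem measurableSet_pathsAvoiding {S : Type*} [MeasurableSpace S] [DiscreteMeasurableSpace S]
    (T : Set S) (n : ℕ) : MeasurableSet (pathsAvoiding T n) := by
  have : pathsAvoiding T n = ⋂ j, ⋂ _ : j < n, (fun ω : ℕ → S => ω j) ⁻¹' Tᶜ := by
    ext; simp [pathsAvoiding]
  rw [this]
  exact .iInter fun j => .iInter fun _ => measurable_pi_apply j (.of_discrete)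

/-- The total of `c` along a path, counted at the times up to which `T` is avoided. -/
noncomputable def costBefore {S : Type*} (T : Set S) (c : S → ℝ≥0∞) (ω : ℕ → S) : ℝ≥0∞ :=
  ∑' k, (pathsAvoiding T (k + 1)).indicator (fun ω => c (ω k)) ω

namespace DTMC

variable {S A : Type*} [Fintype S] [MeasurableSpace S] [DiscreteMeasurableSpace S] (D : DTMC S A)

theorem measurable_indicator_pathsAvoiding (T : Set S) (c : S → ℝ≥0∞) (n k : ℕ) :
    Measurable ((pathsAvoiding T n).indicator fun ω => c (ω k)) :=
  ((measurable_of_countable c).comp (measurable_pi_apply k)).indicator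
    (measurableSet_pathsAvoiding T n)

/-- Park induction for expected costs: a supersolution `y` of the one-step inequality outside `T`
bounds the expected cost collected before `T`. -/
theorem lintegral_costBefore_le (T : Set S) (c y : S → ℝ≥0∞)
    (hy : ∀ s ∉ T, c s + ∑ s', D.step s s' * y s' ≤ y s) (s : S) :
    ∫⁻ ω, costBefore T c ω ∂D.pathMeasure s ≤ y s := by
  have hstep (n : ℕ) :
      ∫⁻ ω, (pathsAvoiding T (n + 1)).indicator (fun ω => c (ω n)) ω ∂D.pathMeasure s +
        ∫⁻ ω, (pathsAvoiding T (n + 1)).indicator (fun ω => y (ω (n + 1))) ω ∂D.pathMeasure s ≤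
      ∫⁻ ω, (pathsAvoiding T n).indicator (fun ω => y (ω n)) ω ∂D.pathMeasure s := by
    -- Avoidance at times `0, …, n` depends only on the history, so it passes through the one-step
    -- expectation.
    let B : Set (Π _ : Finset.Iic n, S) := {h | ∀ j, h j ∉ T}
    have hB (ω : ℕ → S) : Preorder.frestrictLe n ω ∈ B ↔ ω ∈ pathsAvoiding T (n + 1) := by
      simp [B, pathsAvoiding]
    have hnext := D.lintegral_pathMeasure_succ s n fun h s' => B.indicator (fun _ => y s') h
    have hind (ω : ℕ → S) (a : ℝ≥0∞) : B.indicator (fun _ => a) (Preorder.frestrictLe n ω) =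
        (pathsAvoiding T (n + 1)).indicator (fun _ => a) ω := by
      classical simp only [Set.indicator_apply, hB]
    simp only [hind] at hnext
    have hnext' :
        ∫⁻ ω, (pathsAvoiding T (n + 1)).indicator (fun ω => y (ω (n + 1))) ω ∂D.pathMeasure s =
        ∫⁻ ω, ∑ s', D.step (ω n) s' * (pathsAvoiding T (n + 1)).indicator (fun _ => y s') ω
          ∂D.pathMeasure s := hnext
    rw [hnext', ← lintegral_add_left (measurable_indicator_pathsAvoiding T c _ _)]
    refine lintegral_mono fun ω => ?_
    by_cases hω : ω ∈ pathsAvoiding T (n + 1)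
    · have hω' : ω ∈ pathsAvoiding T n := fun j hj => hω j (hj.trans n.lt_succ_self)
      simpa [hω, hω'] using hy (ω n) (hω n n.lt_succ_self)
    · simp [hω]
  have hsum (n : ℕ) :
      ∑ k ∈ Finset.range n,
        ∫⁻ ω, (pathsAvoiding T (k + 1)).indicator (fun ω => c (ω k)) ω ∂D.pathMeasure s +
        ∫⁻ ω, (pathsAvoiding T n).indicator (fun ω => y (ω n)) ω ∂D.pathMeasure s ≤ y s := by
    induction n with
    | zero => simp [pathsAvoiding, D.lintegral_pathMeasure_zero]
    | succ n ih =>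
      rw [Finset.sum_range_succ, add_assoc]
      exact (add_le_add_right (hstep n) _).trans ih
  unfold costBefore
  rw [lintegral_tsum fun k => (measurable_indicator_pathsAvoiding T c _ _).aemeasurable,
    ENNReal.tsum_eq_iSup_nat]
  exact iSup_le fun n => le_self_add.trans (hsum n)

/-- If the expected number of steps before `T` has a finite bound, then `T` is reached almost
surely. -/
theorem ae_exists_mem (T : Set S) (y : S → ℝ≥0∞)
    (hy : ∀ s ∉ T, 1 + ∑ s', D.step s s' * y s' ≤ y s) {s : S} (hs : y s ≠ ∞) :
    ∀ᵐ ω ∂D.pathMeasure s, ∃ i, ω i ∈ T := by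
  have hle := D.lintegral_costBefore_le T (fun _ => 1) y hy s
  have hmeas : Measurable (costBefore T fun _ => 1) :=
    Measurable.tsum fun k => measurable_indicator_pathsAvoiding T (fun _ => 1) _ k
  filter_upwards [ae_lt_top hmeas (ne_top_of_le_ne_top hs hle)] with ω hω
  by_contra! hT
  have havoid (k : ℕ) : ω ∈ pathsAvoiding T (k + 1) := fun j _ => hT j
  -- A path avoiding `T` forever pays 1 at every time, hence `∞` in total.
  simp [costBefore, havoid] at hω

/-- On paths that reach `T`, the reward is a partial sum of `costBefore`, because the indicators
equal 1 before the first visit. -/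
theorem expReward_le (T : Set S) (rew : S → ℝ≥0) (x : S → ℝ≥0∞)
    (hx : ∀ s ∉ T, rew s + ∑ s', D.step s s' * x s' ≤ x s) {s : S}
    (hs : ∀ᵐ ω ∂D.pathMeasure s, ∃ i, ω i ∈ T) : D.expReward T rew s ≤ x s := by
  refine (lintegral_mono_ae ?_).trans (D.lintegral_costBefore_le T (fun u => rew u) x hx s)
  filter_upwards [hs] with ω hω
  rw [rewardUntil, if_pos hω, costBefore]
  refine le_trans (le_of_eq ?_) (ENNReal.sum_le_tsum (Finset.range (sInf {i | ω i ∈ T})))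
  refine Finset.sum_congr rfl fun k hk => ?_
  rw [Set.indicator_of_mem]
  intro j hj hjT
  have : sInf {i | ω i ∈ T} ≤ j := Nat.sInf_le hjT
  have := Finset.mem_range.1 hk
  omega

end DTMC

/-- A rank function on a set `F` that is closed under transitions outside `T`, such that every state
in `F \ T` has a successor of smaller rank, yields a finite bound on expected hitting times. -/
theorem exists_hittingTime_bound {S : Type*} [Fintype S] (q : S → PMF S) (T F : Set S)
    (hF : ∀ s ∈ F \ T, ∀ s', q s s' ≠ 0 → s' ∈ F) (ρ : S → ℕ)
    (hρ : ∀ s ∈ F \ T, ∃ s', q s s' ≠ 0 ∧ ρ s' < ρ s) :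
    ∃ y : S → ℝ≥0∞, (∀ s ∈ F, y s ≠ ∞) ∧ ∀ s ∉ T, 1 + ∑ s', q s s' * y s' ≤ y s := by
  classical
  let Q : S → S → ℝ := fun s s' => (q s s').toReal
  have hQ0 (s s' : S) : 0 ≤ Q s s' := ENNReal.toReal_nonneg
  have hQ1 (s : S) : ∑ s', Q s s' = 1 := by
    have := (q s).tsum_coe
    rw [tsum_fintype] at this
    rw [← ENNReal.toReal_sum fun s' _ => (q s).apply_ne_top s', this, ENNReal.toReal_one]
  have hQpos {s s' : S} (h : q s s' ≠ 0) : 0 < Q s s' :=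
    ENNReal.toReal_pos h ((q s).apply_ne_top s')
  -- The factor 2 makes the expectation of `δ ^ ρ` at least double in one step (`hgrow`).
  obtain ⟨δ, ⟨hδ, hδ1⟩, hδ0⟩ : ∃ δ : ℝ,
      ((∀ s s', q s s' ≠ 0 → 2 * δ ≤ Q s s') ∧ δ ≤ 1) ∧ 0 < δ := by
    have hev : ∀ ε > (0 : ℝ), ∀ᶠ δ in nhdsWithin (0 : ℝ) (Set.Ioi 0), 2 * δ ≤ ε := fun ε hε => by
      filter_upwards [Ioo_mem_nhdsGT (half_pos hε)] with δ h
      linarith [h.2]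
    have h1 : ∀ᶠ δ in nhdsWithin (0 : ℝ) (Set.Ioi 0), ∀ s s', q s s' ≠ 0 → 2 * δ ≤ Q s s' := by
      simp only [Filter.eventually_all]
      exact fun s s' h => hev _ (hQpos h)
    have h2 : ∀ᶠ δ in nhdsWithin (0 : ℝ) (Set.Ioi 0), δ ≤ 1 := by
      filter_upwards [hev 2 two_pos] with δ h
      linarith
    exact ((h1.and h2).and self_mem_nhdsWithin).exists
  -- By the doubling, `z = C * (1 - δ ^ ρ)` drops by at least `C * δ ^ ρ s` in expectation; this `C`
  -- makes the drop at least 1 at every state.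
  let C : ℝ := ∑ s, (δ ^ ρ s)⁻¹
  have hC (s : S) : 1 ≤ C * δ ^ ρ s := by
    rw [← div_le_iff₀ (by positivity), one_div]
    exact Finset.single_le_sum (f := fun s => (δ ^ ρ s)⁻¹) (fun _ _ => by positivity)
      (Finset.mem_univ s)
  have hC0 : 0 ≤ C := Finset.sum_nonneg fun _ _ => by positivity
  let z : S → ℝ := fun s => C * (1 - δ ^ ρ s)
  have hz0 (s : S) : 0 ≤ z s := mul_nonneg hC0 (sub_nonneg.2 (pow_le_one₀ hδ0.le hδ1))
  refine ⟨fun s => if s ∈ F then ENNReal.ofReal (z s) else ∞, fun s hs => by simp [hs],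
    fun s hsT => ?_⟩
  by_cases hs : s ∈ F
  swap
  · simp [hs]
  -- By closure, the value `∞` off `F` only occurs with weight 0, and `0 * ∞ = 0`.
  have hterm (s' : S) : q s s' * (if s' ∈ F then ENNReal.ofReal (z s') else ∞) =
      ENNReal.ofReal (Q s s' * z s') := by
    by_cases h0 : q s s' = 0
    · simp [h0, Q]
    · rw [if_pos (hF s ⟨hs, hsT⟩ s' h0), ENNReal.ofReal_mul (hQ0 s s'),
        ENNReal.ofReal_toReal ((q s).apply_ne_top s')]
  simp only [hterm, if_pos hs]
  rw [← ENNReal.ofReal_sum_of_nonneg fun s' _ => mul_nonneg (hQ0 s s') (hz0 s'),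
    ← ENNReal.ofReal_one, ← ENNReal.ofReal_add zero_le_one
      (Finset.sum_nonneg fun s' _ => mul_nonneg (hQ0 s s') (hz0 s'))]
  refine ENNReal.ofReal_le_ofReal ?_
  have hsum : ∑ s', Q s s' * z s' = C - C * ∑ s', Q s s' * δ ^ ρ s' := by
    calc ∑ s', Q s s' * z s' = ∑ s', (C * Q s s' - C * (Q s s' * δ ^ ρ s')) :=
          Finset.sum_congr rfl fun s' _ => by ring
      _ = _ := by rw [Finset.sum_sub_distrib, ← Finset.mul_sum, ← Finset.mul_sum, hQ1, mul_one]
  have hgrow : 2 * δ ^ ρ s ≤ ∑ s', Q s s' * δ ^ ρ s' := by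
    obtain ⟨t, ht, hlt⟩ := hρ s ⟨hs, hsT⟩
    calc 2 * δ ^ ρ s ≤ 2 * δ ^ (ρ t + 1) :=
          mul_le_mul_of_nonneg_left (pow_le_pow_of_le_one hδ0.le hδ1 hlt) zero_le_two
      _ = 2 * δ * δ ^ ρ t := by ring
      _ ≤ Q s t * δ ^ ρ t := mul_le_mul_of_nonneg_right (hδ s t ht) (by positivity)
      _ ≤ _ := Finset.single_le_sum (f := fun s' => Q s s' * δ ^ ρ s')
          (fun s' _ => mul_nonneg (hQ0 s s') (by positivity)) (Finset.mem_univ t)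
  have := mul_le_mul_of_nonneg_left hgrow hC0
  have := hC s
  rw [hsum]
  simp only [z]
  linarith

theorem MDP.induced_step_apply {S A : Type*} [Fintype S] (M : MDP S A) (σ : M.Strategy)
    (s s' : S) : (M.induced σ).step s s' = M.P s (σ.1 s) s' := by
  have hact : (M.induced σ).action s = σ.1 s :=
    ((M.induced σ).unique_enabled s).unique ((M.induced σ).unique_enabled s).choose_spec.1
      (by simpa [MDP.induced, MDP.act] using σ.2 s)
  have hP : (M.induced σ).P s (σ.1 s) s' = M.P s (σ.1 s) s' := by simp [MDP.induced]
  rw [DTMC.step, PMF.ofFintype_apply, hact, hP]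

theorem MDP.IsValidUpperMax.rew_add_sum_le {S A : Type*} [Fintype S] {M : MDP S A} {T : Set S}
    {rew : S → ℝ≥0} {x : S → ℝ≥0∞} {r : S → ℕ∞} (h : M.IsValidUpperMax T rew x r)
    (σ : M.Strategy) {s : S} (hs : s ∉ T) :
    rew s + ∑ s', (M.induced σ).step s s' * x s' ≤ x s := by
  have hle := h.bellman_le s
  rw [MDP.bellmanMax, if_neg hs] at hle
  refine le_trans (add_le_add_right ?_ _) hle
  refine le_trans (le_of_eq ?_) (le_iSup₂_of_le (σ.1 s) (σ.2 s) le_rfl)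
  simp only [MDP.induced_step_apply]
  refine (Finset.sum_subset (Finset.subset_univ _) fun s' _ hs' => ?_).symm
  have : M.P s (σ.1 s) s' = 0 := by simpa [MDP.post] using hs'
  simp [this]

theorem MDP.IsValidUpperMax.exists_rank_lt {S A : Type*} [Fintype S] {M : MDP S A} {T : Set S}
    {rew : S → ℝ≥0} {x : S → ℝ≥0∞} {r : S → ℕ∞} (h : M.IsValidUpperMax T rew x r)
    (σ : M.Strategy) {s : S} (hs : s ∉ T) (hr : r s < ⊤) :
    ∃ s', (M.induced σ).step s s' ≠ 0 ∧ r s' < r s := by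
  have hle := h.dist_le s
  rw [MDP.distMax, if_neg hs] at hle
  -- Finiteness of `r s` is what turns `1 + inf ≤ r s` into a strict inequality.
  have hlt : ⨅ s' ∈ M.post s (σ.1 s), r s' < r s := by
    refine (ENat.add_one_le_iff' hr.ne).1 (le_trans ?_ hle)
    rw [add_comm 1]
    gcongr
    exact le_iSup₂_of_le (f := fun a (_ : a ∈ M.act s) => ⨅ s' ∈ M.post s a, r s') (σ.1 s) (σ.2 s)
      le_rfl
  obtain ⟨s', hs'⟩ := iInf_lt_iff.1 hlt
  obtain ⟨hpost, hs'⟩ := iInf_lt_iff.1 hs'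
  refine ⟨s', ?_, hs'⟩
  rw [MDP.induced_step_apply]
  have : 0 < M.P s (σ.1 s) s' := by simpa [MDP.post] using hpost
  exact_mod_cast this.ne'

theorem mainTheorem10 {S A : Type*} [Fintype S] [Finite A]
    [MeasurableSpace S] [DiscreteMeasurableSpace S]
    (M : MDP S A) (T : Set S) (rew : S → ℝ≥0) (x : S → ℝ≥0∞) (r : S → ℕ∞)
    (h : M.IsValidUpperMax T rew x r) (s : S) :
    M.expRewardMax T rew s ≤ x s := by
  refine iSup_le fun σ => ?_
  rcases eq_or_ne (x s) ∞ with hs | hs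
  · simp [hs]
  have hclosed : ∀ u ∈ {u | x u ≠ ∞} \ T, ∀ u', (M.induced σ).step u u' ≠ 0 →
      u' ∈ {u | x u ≠ ∞} := fun u hu u' hu' hx => by
    -- A successor of positive probability with value `∞` would force `x u = ∞`.
    refine hu.1 (top_le_iff.1 (le_trans ?_ (h.rew_add_sum_le σ hu.2)))
    refine le_trans (le_of_eq ?_) (le_add_left (Finset.single_le_sum
      (f := fun u' => (M.induced σ).step u u' * x u') (fun _ _ => zero_le) (Finset.mem_univ u')))
    rw [hx, ENNReal.mul_top hu']
  have hrank : ∀ u ∈ {u | x u ≠ ∞} \ T, ∃ u', (M.induced σ).step u u' ≠ 0 ∧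
      (r u').toNat < (r u).toNat := fun u hu => by
    have hr := h.finite_rank u (lt_top_iff_ne_top.2 hu.1)
    obtain ⟨u', hstep, hlt⟩ := h.exists_rank_lt σ hu.2 hr
    refine ⟨u', hstep, ?_⟩
    rwa [← Nat.cast_lt (α := ℕ∞), ENat.natCast_toNat (hlt.trans hr).ne, ENat.natCast_toNat hr.ne]
  obtain ⟨y, hyF, hy⟩ := exists_hittingTime_bound (M.induced σ).step T {u | x u ≠ ∞} hclosed
    (fun u => (r u).toNat) hrank
  exact (M.induced σ).expReward_le T rew x (fun u hu => h.rew_add_sum_le σ hu)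
    ((M.induced σ).ae_exists_mem T y hy (hyF s hs))
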